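/- Let $T$ be a tree on $n \ge 3$ vertices with $p$ leaves (vertices of degree $1$), and let $d_{x,y}$ denote the number of edges of the path between the vertices $x$ and $y$ of $T$. Let $\mathrm{Max4PC}_T$ be the real symmetric $\binom{n}{2}\times\binom{n}{2}$ matrix whose rows and columns are indexed by the unordered pairs of distinct vertices of $T$ and whose entry in row $\{w,x\}$ and column $\{y,z\}$ is $$\max\bigl\{d_{w,x}+d_{y,z},\; d_{w,y}+d_{x,z},\; d_{w,z}+d_{x,y}\bigr\}.$$ Let $n_0$, $n_+$, $n_-$ be the numbers of zero, positive and negative eigenvalues of $\mathrm{Max4PC}_T$, counted with multiplicity. Then $$(n_0, n_+, n_-) = \left(\binom{n}{2}-2(n-p),\; n-p,\; n-p\right),$$ and the nullity (dimension of the kernel) of $\mathrm{Max4PC}_T$ is $\binom{n}{2}-2(n-p)$. -/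

import Mathlib

/-- Unordered pairs of distinct elements of `V`. -/
abbrev VertexPair (V : Type*) : Type _ := {e : Sym2 V // ¬ e.IsDiag}

/-- The maximum of `d(w,x) + d(y,z)`, `d(w,y) + d(x,z)` and `d(w,z) + d(x,y)`, where `d` is the
graph distance. -/
noncomputable def fourPointMax {V : Type*} (T : SimpleGraph V) (w x y z : V) : ℕ :=
  max (T.dist w x + T.dist y z) (max (T.dist w y + T.dist x z) (T.dist w z + T.dist x y))

theorem fourPointMax_swap_left {V : Type*} (T : SimpleGraph V) (w x y z : V) :
    fourPointMax T w x y z = fourPointMax T x w y z := by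
  simp only [fourPointMax, T.dist_comm (u := w) (v := x)]
  rw [max_comm (T.dist w y + _), add_comm (T.dist w z), add_comm (T.dist w y)]

theorem fourPointMax_swap_right {V : Type*} (T : SimpleGraph V) (w x y z : V) :
    fourPointMax T w x y z = fourPointMax T w x z y := by
  simp only [fourPointMax, T.dist_comm (u := y) (v := z)]
  rw [max_comm (T.dist w y + _)]

theorem fourPointMax_comm {V : Type*} (T : SimpleGraph V) (w x y z : V) :
    fourPointMax T w x y z = fourPointMax T y z w x := by
  simp only [fourPointMax, T.dist_comm (u := y) (v := w), T.dist_comm (u := z) (v := x),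
    T.dist_comm (u := y) (v := x), T.dist_comm (u := z) (v := w)]
  rw [add_comm (T.dist w x), add_comm (T.dist w z)]

/-- `fourPointMax` as a function of the two unordered pairs `{w, x}` and `{y, z}`. -/
noncomputable def fourPointMaxSym {V : Type*} (T : SimpleGraph V) : Sym2 V → Sym2 V → ℕ :=
  Sym2.lift₂ ⟨fourPointMax T, fun w x y z =>
    ⟨fourPointMax_swap_left T w x y z, fourPointMax_swap_right T w x y z⟩⟩

theorem fourPointMaxSym_mk {V : Type*} (T : SimpleGraph V) (w x y z : V) :
    fourPointMaxSym T s(w, x) s(y, z) = fourPointMax T w x y z := rfl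

/-- The maximum four-point-condition matrix of `T`, with rows and columns indexed by the unordered
pairs of distinct vertices. -/
noncomputable def Max4PC {V : Type*} (T : SimpleGraph V) :
    Matrix (VertexPair V) (VertexPair V) ℝ :=
  Matrix.of fun e f => (fourPointMaxSym T e.1 f.1 : ℝ)

theorem Max4PC_isHermitian {V : Type*} (T : SimpleGraph V) : (Max4PC T).IsHermitian := by
  ext ⟨e, he⟩ ⟨f, hf⟩
  induction e using Sym2.ind with | _ w x
  induction f using Sym2.ind with | _ y z
  simp [Max4PC, fourPointMaxSym_mk, fourPointMax_comm T y z w x]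

/-- The inertia `(n₀, n₊, n₋)` of a real symmetric matrix: the numbers of zero, positive and
negative eigenvalues, counted with multiplicity. -/
noncomputable def inertia {ι : Type*} [Fintype ι] [DecidableEq ι] {A : Matrix ι ι ℝ}
    (hA : A.IsHermitian) : ℕ × ℕ × ℕ :=
  ((Finset.univ.filter fun i => hA.eigenvalues i = 0).card,
    (Finset.univ.filter fun i => 0 < hA.eigenvalues i).card,
    (Finset.univ.filter fun i => hA.eigenvalues i < 0).card)

/-- The number of leaves (vertices of degree one) of a finite graph. -/
def numLeaves {V : Type*} [Fintype V] (T : SimpleGraph V) [DecidableRel T.Adj] : ℕ :=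
  (Finset.univ.filter fun v => T.degree v = 1).card

/-! Root `T` at a non-leaf `r`. Since `d(x,y)` is the sum of the depths minus twice the number of
common non-root ancestors, the four-point maximum is the sum of the four depths minus twice the
least of three counts, one per pairing. Descendant sets are laminar, so this least count is a sum
over `v` of terms that are bilinear in "both below `v`" and "some below `v`"
(`IsTree.fourPointMax_add_two_mul_card`).

Hence the matrix is a sum of hyperbolic planes `p ⊗ q + q ⊗ p`: the root carries the pair (constant
`1`, depth sum), and every other `v` carries (both below, `-2` some below). A leaf is never
below-or-equal to two distinct vertices, so its plane vanishes and `n - p` planes remain. Their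
vectors are linearly independent (`IsTree.coefficients_eq_zero`), so each plane contributes one
positive and one negative eigenvalue (`inertia_of_hyperbolic`). -/

namespace SimpleGraph

/-! ### Rooted trees: parents, ancestors and distances -/

variable {V : Type*} {T : SimpleGraph V}

/-- Every vertex other than `x` has a neighbour that is one step closer to `x`. -/
theorem Connected.exists_adj_dist_add_one_eq (hT : T.Connected) {x y : V} (h : y ≠ x) :
    ∃ b, T.Adj y b ∧ T.dist b x + 1 = T.dist y x := by
  obtain ⟨p, hp⟩ := hT.exists_walk_length_eq_dist y x
  cases p with
  | nil => exact absurd rfl h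
  | @cons _ b _ hb q =>
    refine ⟨b, hb, ?_⟩
    have h1 := dist_le q
    have h2 := hT.dist_triangle (u := y) (v := b) (w := x)
    rw [dist_eq_one_iff_adj.2 hb] at h2
    simp only [Walk.length_cons] at hp
    omega

/-- In a tree, the neighbour of `y` that is closer to `x` is unique. -/
theorem IsTree.eq_of_adj_of_dist_add_one_eq (hT : T.IsTree) {a b x y : V}
    (ha : T.Adj y a) (hb : T.Adj y b) (hax : T.dist a x + 1 = T.dist y x)
    (hbx : T.dist b x + 1 = T.dist y x) : a = b := by
  obtain ⟨p, hp⟩ := hT.connected.exists_walk_length_eq_dist a x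
  obtain ⟨q, hq⟩ := hT.connected.exists_walk_length_eq_dist b x
  have h1 : (Walk.cons ha p).IsPath :=
    Walk.isPath_of_length_eq_dist _ (by rw [Walk.length_cons, hp, hax])
  have h2 : (Walk.cons hb q).IsPath :=
    Walk.isPath_of_length_eq_dist _ (by rw [Walk.length_cons, hq, hbx])
  have h3 := congrArg (fun w => Walk.snd w.1)
    ((hT.isAcyclic.subsingleton_path y x).elim ⟨Walk.cons ha p, h1⟩ ⟨Walk.cons hb q, h2⟩)
  simpa using h3

/-- In the tree `T` rooted at `r`, the vertex `v` lies on the path from `r` to `x`. -/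
def IsAncestor (T : SimpleGraph V) (r v x : V) : Prop :=
  T.dist r x = T.dist r v + T.dist v x

theorem isAncestor_refl (r x : V) : T.IsAncestor r x x := by simp [IsAncestor]

theorem Connected.isAncestor_root_iff (hT : T.Connected) {r v : V} :
    T.IsAncestor r v r ↔ v = r := by
  constructor
  · intro h
    simp only [IsAncestor, dist_self] at h
    exact hT.dist_eq_zero_iff.1 (by omega)
  · rintro rfl
    exact isAncestor_refl _ _

theorem Connected.isAncestor_trans (hT : T.Connected) {r u v x : V}
    (huv : T.IsAncestor r u v) (hvx : T.IsAncestor r v x) : T.IsAncestor r u x := by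
  unfold IsAncestor at *
  have h1 := hT.dist_triangle (u := u) (v := v) (w := x)
  have h2 := hT.dist_triangle (u := r) (v := u) (w := x)
  omega

/-- `p` is the parent of `y` in the tree `T` rooted at `r`. -/
def IsParent (T : SimpleGraph V) (r p y : V) : Prop :=
  T.Adj y p ∧ T.dist r p + 1 = T.dist r y

theorem Connected.exists_isParent (hT : T.Connected) {r y : V} (h : y ≠ r) :
    ∃ p, T.IsParent r p y := by
  obtain ⟨b, hb, h⟩ := hT.exists_adj_dist_add_one_eq h
  exact ⟨b, hb, by rw [dist_comm, h, dist_comm]⟩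

theorem IsTree.isParent_unique (hT : T.IsTree) {r p q y : V} (hp : T.IsParent r p y)
    (hq : T.IsParent r q y) : p = q :=
  hT.eq_of_adj_of_dist_add_one_eq (x := r) hp.1 hq.1
    (by rw [dist_comm, hp.2, dist_comm]) (by rw [dist_comm, hq.2, dist_comm])

theorem IsParent.ne_root {r p y : V} (h : T.IsParent r p y) : y ≠ r := by
  rintro rfl
  have := h.2
  simp at this

theorem IsParent.isAncestor {r p y : V} (h : T.IsParent r p y) : T.IsAncestor r p y := by
  unfold IsAncestor
  rw [dist_eq_one_iff_adj.2 h.1.symm, h.2]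

theorem IsTree.isParent_or_isParent (hT : T.IsTree) (r : V) {x y : V} (h : T.Adj x y) :
    T.IsParent r x y ∨ T.IsParent r y x := by
  rcases hT.dist_eq_dist_add_one_of_adj r h with h1 | h1
  · exact Or.inr ⟨h, h1.symm⟩
  · exact Or.inl ⟨h.symm, h1.symm⟩

theorem IsTree.isAncestor_iff_of_isParent (hT : T.IsTree) {r p v y : V}
    (hp : T.IsParent r p y) : T.IsAncestor r v y ↔ v = y ∨ T.IsAncestor r v p := by
  constructor
  · intro h
    by_cases hvy : v = y
    · exact Or.inl hvy
    right
    obtain ⟨b, hb, hbv⟩ := hT.connected.exists_adj_dist_add_one_eq (Ne.symm hvy)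
    have h1 := hT.connected.dist_triangle (u := r) (v := v) (w := b)
    have h2 := hT.connected.dist_triangle (u := r) (v := b) (w := y)
    rw [dist_comm (u := v)] at h1
    rw [dist_eq_one_iff_adj.2 hb.symm] at h2
    unfold IsAncestor at *
    rw [dist_comm (u := v)] at h ⊢
    obtain rfl := hT.isParent_unique hp (⟨hb, by omega⟩ : T.IsParent r b y)
    omega
  · rintro (rfl | h)
    · exact isAncestor_refl _ _
    · exact hT.connected.isAncestor_trans h hp.isAncestor

theorem IsParent.not_isAncestor {r p y : V} (h : T.IsParent r p y) :
    ¬ T.IsAncestor r y p := by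
  unfold IsAncestor
  have := h.2
  omega

/-- Induction on the vertices of a rooted tree, from the root downwards. -/
theorem Connected.induction_on_isParent (hT : T.Connected) (r : V) {P : V → Prop} (root : P r)
    (step : ∀ p y, T.IsParent r p y → P p → P y) (y : V) : P y := by
  induction hk : T.dist r y generalizing y with
  | zero => rwa [← hT.dist_eq_zero_iff.1 hk]
  | succ k ih =>
    have hy : y ≠ r := by
      rintro rfl
      simp at hk
    obtain ⟨p, hp⟩ := hT.exists_isParent hy
    exact step p y hp (ih p (by have := hp.2; omega))

/-- Parents are unique, so the ancestors of `x` form a chain. This is the source of laminarity. -/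
theorem IsTree.isAncestor_total (hT : T.IsTree) {r : V} (x : V) {u v : V}
    (hu : T.IsAncestor r u x) (hv : T.IsAncestor r v x) :
    T.IsAncestor r u v ∨ T.IsAncestor r v u := by
  induction x using hT.connected.induction_on_isParent r with
  | root =>
    rw [hT.connected.isAncestor_root_iff] at hu hv
    subst hu hv
    exact Or.inl (isAncestor_refl _ _)
  | step p y hp ih =>
    rcases (hT.isAncestor_iff_of_isParent hp).1 hu with rfl | hu'
    · exact Or.inr hv
    rcases (hT.isAncestor_iff_of_isParent hp).1 hv with rfl | hv'
    · exact Or.inl hu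
    exact ih hu' hv'

/-- If `y` lies between its parent and `x`, then `y` is an ancestor of `x`. -/
theorem IsTree.isAncestor_of_dist_isParent (hT : T.IsTree) {r p y : V} (hp : T.IsParent r p y)
    (x : V) (h : T.dist x p = T.dist x y + 1) : T.IsAncestor r y x := by
  induction hk : T.dist x y generalizing x with
  | zero =>
    rw [hT.connected.dist_eq_zero_iff.1 hk]
    exact isAncestor_refl _ _
  | succ k ih =>
    have hxy : x ≠ y := by
      rintro rfl
      simp at hk
    obtain ⟨b, hb, hby⟩ := hT.connected.exists_adj_dist_add_one_eq hxy
    have h1 := hT.connected.dist_triangle (u := b) (v := y) (w := p)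
    have h2 := hT.connected.dist_triangle (u := x) (v := b) (w := p)
    rw [dist_eq_one_iff_adj.2 hp.1] at h1
    rw [dist_eq_one_iff_adj.2 hb] at h2
    -- The triangle inequalities squeeze `dist b p` to `dist b y + 1`, so `b` inherits the
    -- hypothesis on `x`.
    have hyb := ih b (by omega) (by omega)
    rcases hT.isParent_or_isParent r hb with hx | hx
    · rcases (hT.isAncestor_iff_of_isParent hx).1 hyb with rfl | hyx
      · obtain rfl := hT.isParent_unique hp hx
        simp at h
      · exact hyx
    · exact hT.connected.isAncestor_trans hyb hx.isAncestor

open Classical in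
/-- The non-root ancestors of `x`, including `x` itself. -/
noncomputable def properAncestors [Fintype V] (T : SimpleGraph V) (r x : V) : Finset V :=
  Finset.univ.filter fun v => v ≠ r ∧ T.IsAncestor r v x

theorem mem_properAncestors [Fintype V] {r v x : V} :
    v ∈ T.properAncestors r x ↔ v ≠ r ∧ T.IsAncestor r v x := by
  simp [properAncestors]

theorem Connected.properAncestors_root [Fintype V] (hT : T.Connected) (r : V) :
    T.properAncestors r r = ∅ := by
  ext v
  simp [mem_properAncestors, hT.isAncestor_root_iff]

theorem IsTree.properAncestors_of_isParent [Fintype V] [DecidableEq V] (hT : T.IsTree)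
    {r p y : V} (hp : T.IsParent r p y) :
    T.properAncestors r y = insert y (T.properAncestors r p) := by
  ext v
  rw [Finset.mem_insert, mem_properAncestors, mem_properAncestors,
    hT.isAncestor_iff_of_isParent hp]
  have := hp.ne_root
  aesop

theorem IsParent.notMem_properAncestors [Fintype V] {r p y : V} (hp : T.IsParent r p y) :
    y ∉ T.properAncestors r p := fun h => hp.not_isAncestor (mem_properAncestors.1 h).2

/-- In a rooted tree, the distance of two vertices in terms of their common ancestors. -/
theorem IsTree.dist_add_two_mul_card_inter [Fintype V] [DecidableEq V] (hT : T.IsTree) (r x y : V) :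
    T.dist x y + 2 * (T.properAncestors r x ∩ T.properAncestors r y).card =
      T.dist r x + T.dist r y := by
  induction y using hT.connected.induction_on_isParent r with
  | root => simp [hT.connected.properAncestors_root, dist_comm]
  | step p y hp ih =>
    rw [hT.properAncestors_of_isParent hp]
    have hr := hp.2
    -- Passing from `p` to its child `y` adds one common ancestor exactly when `y` is above `x`,
    -- which is when the distance to `x` drops rather than grows.
    by_cases h : y ∈ T.properAncestors r x
    · rw [Finset.inter_insert_of_mem h, Finset.card_insert_of_notMem
        (fun h' => hp.notMem_properAncestors (Finset.mem_inter.1 h').2)]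
      have h1 := (mem_properAncestors.1 h).2
      unfold IsAncestor at h1
      have h2 := hT.connected.dist_triangle (u := r) (v := p) (w := x)
      have h3 := hT.connected.dist_triangle (u := p) (v := y) (w := x)
      rw [dist_eq_one_iff_adj.2 hp.1.symm] at h3
      rw [dist_comm (u := x)] at ih ⊢
      omega
    · rw [Finset.inter_insert_of_notMem h]
      rcases hT.dist_eq_dist_add_one_of_adj x hp.1 with h1 | h1
      · omega
      · exact absurd (mem_properAncestors.2
          ⟨hp.ne_root, hT.isAncestor_of_dist_isParent hp x h1⟩) h

end SimpleGraph

/-! ### Inertia of a sum of hyperbolic planes -/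

section signature
open Matrix

/-- If `ε` times the quadratic form of `A` is nonpositive on the common kernel of a family of
linear forms, then at most as many eigenvalues of `A` as there are forms in the family have the
sign of `ε`. -/
theorem Matrix.IsHermitian.card_filter_mul_eigenvalues_pos_le {P ι : Type*} [Fintype P]
    [DecidableEq P] [Fintype ι] {A : Matrix P P ℝ} (hA : A.IsHermitian) (ε : ℝ) (U : ι → P → ℝ)
    (h : ∀ x, (∀ i, U i ⬝ᵥ x = 0) → ε * (x ⬝ᵥ A *ᵥ x) ≤ 0) :
    (Finset.univ.filter fun i => 0 < ε * hA.eigenvalues i).card ≤ Fintype.card ι := by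
  by_contra! hlt
  set s := Finset.univ.filter fun i => 0 < ε * hA.eigenvalues i with hs
  let b : P → P → ℝ := fun j => ⇑(hA.eigenvectorBasis j)
  have horth : ∀ j k, b j ⬝ᵥ b k = if j = k then 1 else 0 := by
    intro j k
    have h1 := orthonormal_iff_ite.1 hA.eigenvectorBasis.orthonormal k j
    rw [EuclideanSpace.inner_eq_star_dotProduct] at h1
    simpa [eq_comm, b] using h1
  let comb : (s → ℝ) →ₗ[ℝ] (P → ℝ) := Fintype.linearCombination ℝ (fun j : s => b j)
  let F : (s → ℝ) →ₗ[ℝ] (ι → ℝ) := (Matrix.of U).mulVecLin ∘ₗ comb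
  -- With more eigenvectors of sign `ε` than forms, some nonzero combination of them is killed by
  -- every form.
  have hker : LinearMap.ker F ≠ ⊥ := by
    apply LinearMap.ker_ne_bot_of_finrank_lt
    simpa using hlt
  obtain ⟨c, hc, hc0⟩ := (Submodule.ne_bot_iff _).1 hker
  have hx := h (comb c) (fun i => congrFun (LinearMap.mem_ker.1 hc) i)
  have hcomb : comb c = ∑ j : s, c j • b j := by
    simp [comb, Fintype.linearCombination_apply]
  have hquad : comb c ⬝ᵥ A *ᵥ comb c = ∑ j : s, c j ^ 2 * hA.eigenvalues j := by
    have hb : ∀ j, A *ᵥ b j = hA.eigenvalues j • b j := hA.mulVec_eigenvectorBasis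
    rw [hcomb, Matrix.mulVec_sum, sum_dotProduct]
    refine Finset.sum_congr rfl fun j _ => ?_
    rw [dotProduct_sum, Finset.sum_eq_single j]
    · rw [Matrix.mulVec_smul, hb, smul_dotProduct, dotProduct_smul, dotProduct_smul, horth]
      simp
      ring
    · intro k _ hk
      rw [Matrix.mulVec_smul, hb, smul_dotProduct, dotProduct_smul, dotProduct_smul, horth,
        if_neg (fun h => hk (Subtype.ext h.symm))]
      simp
    · simp
  rw [hquad, Finset.mul_sum] at hx
  obtain ⟨j, hj⟩ := Function.ne_iff.1 hc0
  have hpos : ∀ k : s, 0 < ε * hA.eigenvalues k := fun k => (Finset.mem_filter.1 k.2).2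
  refine absurd hx (not_le.2 (Finset.sum_pos' (fun k _ => ?_) ⟨j, Finset.mem_univ _, ?_⟩))
  · rw [mul_left_comm]
    exact mul_nonneg (sq_nonneg _) (hpos k).le
  · rw [mul_left_comm]
    exact mul_pos (by have : c j ≠ 0 := hj; positivity) (hpos j)

/-- A matrix that is the sum of hyperbolic planes `p i ⊗ q i + q i ⊗ p i`, the vectors `p i` and
`q i` being linearly independent, has as many positive as negative eigenvalues as there are
planes. -/
theorem inertia_of_hyperbolic {P ι : Type*} [Fintype P] [DecidableEq P] [Fintype ι]
    {A : Matrix P P ℝ} (hA : A.IsHermitian) (p q : ι → P → ℝ)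
    (hli : LinearIndependent ℝ (Sum.elim p q))
    (h : ∀ f g, A f g = ∑ i, (p i f * q i g + q i f * p i g)) :
    inertia hA = (Fintype.card P - 2 * Fintype.card ι, Fintype.card ι, Fintype.card ι) ∧
      Module.finrank ℝ (LinearMap.ker A.mulVecLin) = Fintype.card P - 2 * Fintype.card ι := by
  classical
  let X : Matrix (ι ⊕ ι) P ℝ := Matrix.of (Sum.elim p q)
  let Y : Matrix (ι ⊕ ι) P ℝ := Matrix.of (Sum.elim q p)
  have hAXY : A = Xᵀ * Y := by
    ext f g
    rw [h, Matrix.mul_apply, Fintype.sum_sum_type, ← Finset.sum_add_distrib]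
    rfl
  have hliY : LinearIndependent ℝ (Sum.elim q p) := by
    have := hli.comp Sum.swap (Equiv.sumComm ι ι).injective
    convert this using 1
    ext (i | i) f <;> rfl
  have hrankY : Y.rank = 2 * Fintype.card ι := by
    have : LinearIndependent ℝ Y.row := hliY
    rw [this.rank_matrix, Fintype.card_sum, two_mul]
  have hXinj : Function.Injective Xᵀ.mulVec := by
    rw [Matrix.mulVec_injective_iff]
    exact hli
  -- `Xᵀ` is injective, so `Xᵀ * Y` has the rank of `Y`.
  have hrank : A.rank = 2 * Fintype.card ι := by
    rw [← hrankY, hAXY, Matrix.rank, Matrix.mulVecLin_mul, LinearMap.range_comp]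
    exact ((Submodule.equivMapOfInjective Xᵀ.mulVecLin hXinj _).finrank_eq).symm
  have hker : Module.finrank ℝ (LinearMap.ker A.mulVecLin) =
      Fintype.card P - 2 * Fintype.card ι := by
    have h1 := LinearMap.finrank_range_add_finrank_ker A.mulVecLin
    rw [Module.finrank_fintype_fun_eq_card] at h1
    have h2 : Module.finrank ℝ (LinearMap.range A.mulVecLin) = 2 * Fintype.card ι := hrank
    omega
  have hquad : ∀ x, x ⬝ᵥ A *ᵥ x = ∑ i, 2 * (p i ⬝ᵥ x) * (q i ⬝ᵥ x) := by
    intro x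
    rw [hAXY, ← Matrix.mulVec_mulVec, Matrix.dotProduct_mulVec, Matrix.vecMul_transpose]
    change ∑ i, (X *ᵥ x) i * (Y *ᵥ x) i = _
    rw [Fintype.sum_sum_type, ← Finset.sum_add_distrib]
    refine Finset.sum_congr rfl fun i _ => ?_
    change (p i ⬝ᵥ x) * (q i ⬝ᵥ x) + (q i ⬝ᵥ x) * (p i ⬝ᵥ x) = _
    ring
  -- Where all `p i + q i` vanish the form is `-2 ∑ (q i ⬝ᵥ x)²`; using `p i - q i` instead reverses
  -- the sign. The two upper bounds add up to the rank, so both are attained.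
  have hposle := hA.card_filter_mul_eigenvalues_pos_le 1 (fun i => p i + q i) (by
    intro x hx
    rw [hquad, one_mul]
    refine Finset.sum_nonpos fun i _ => ?_
    have := hx i
    rw [add_dotProduct] at this
    rw [eq_neg_of_add_eq_zero_left this]
    nlinarith [sq_nonneg (q i ⬝ᵥ x)])
  have hnegle := hA.card_filter_mul_eigenvalues_pos_le (-1) (fun i => p i - q i) (by
    intro x hx
    rw [hquad, Finset.mul_sum]
    refine Finset.sum_nonpos fun i _ => ?_
    have := hx i
    rw [sub_dotProduct] at this
    rw [sub_eq_zero.1 this]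
    nlinarith [sq_nonneg (q i ⬝ᵥ x)])
  simp only [one_mul, neg_mul, Left.neg_pos_iff] at hposle hnegle
  have hne : (Finset.univ.filter fun i => hA.eigenvalues i ≠ 0).card = 2 * Fintype.card ι := by
    rw [← hrank, hA.rank_eq_card_non_zero_eigs, Fintype.card_subtype]
  have hsplit : (Finset.univ.filter fun i => hA.eigenvalues i ≠ 0).card =
      (Finset.univ.filter fun i => 0 < hA.eigenvalues i).card +
        (Finset.univ.filter fun i => hA.eigenvalues i < 0).card := by
    rw [← Finset.card_union_of_disjoint, ← Finset.filter_or]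
    · congr 1
      ext i
      simp only [Finset.mem_filter, Finset.mem_univ, true_and]
      rw [or_comm, ne_iff_lt_or_gt]
    · exact Finset.disjoint_filter.2 fun i _ h1 h2 => lt_asymm h1 h2
  have hzero : (Finset.univ.filter fun i => hA.eigenvalues i = 0).card +
      (Finset.univ.filter fun i => hA.eigenvalues i ≠ 0).card = Fintype.card P :=
    Finset.card_filter_add_card_filter_not _
  refine ⟨?_, hker⟩
  simp only [inertia, Prod.mk.injEq]
  omega

end signature

/-! ### The four-point maximum, leaves, and linear independence -/

namespace SimpleGraph

variable {V : Type*} {T : SimpleGraph V}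

/-- The maximum of the four-point condition in terms of common ancestors in a rooted tree. -/
theorem IsTree.fourPointMax_add_two_mul_card [Fintype V] [DecidableEq V] (hT : T.IsTree)
    (r w x y z : V) :
    fourPointMax T w x y z + 2 * ∑ v,
        ((if v ∈ T.properAncestors r w ∧ v ∈ T.properAncestors r x then 1 else 0) *
            (if v ∈ T.properAncestors r y ∨ v ∈ T.properAncestors r z then 1 else 0) +
          (if v ∈ T.properAncestors r w ∨ v ∈ T.properAncestors r x then 1 else 0) *
            (if v ∈ T.properAncestors r y ∧ v ∈ T.properAncestors r z then 1 else 0)) =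
      T.dist r w + T.dist r x + (T.dist r y + T.dist r z) := by
  have hcard : ∀ a b, (T.properAncestors r a ∩ T.properAncestors r b).card =
      ∑ v, if v ∈ T.properAncestors r a ∧ v ∈ T.properAncestors r b then 1 else 0 := by
    intro a b
    rw [← Finset.card_filter]
    congr 1
    ext v
    simp
  have hd : ∀ a b c d, T.dist a b + T.dist c d + 2 * ∑ v,
      ((if v ∈ T.properAncestors r a ∧ v ∈ T.properAncestors r b then 1 else 0) +
        (if v ∈ T.properAncestors r c ∧ v ∈ T.properAncestors r d then 1 else 0)) =
      T.dist r a + T.dist r b + (T.dist r c + T.dist r d) := by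
    intro a b c d
    have h1 := hT.dist_add_two_mul_card_inter r a b
    have h2 := hT.dist_add_two_mul_card_inter r c d
    rw [hcard] at h1 h2
    rw [Finset.sum_add_distrib]
    omega
  -- Laminarity: two descendant sets that share a vertex `a` are nested.
  have hlam : ∀ a u v, u ∈ T.properAncestors r a → v ∈ T.properAncestors r a →
      (∀ b, v ∈ T.properAncestors r b → u ∈ T.properAncestors r b) ∨
      (∀ b, u ∈ T.properAncestors r b → v ∈ T.properAncestors r b) := by
    intro a u v hu hv
    simp only [mem_properAncestors] at hu hv ⊢
    exact (hT.isAncestor_total a hu.2 hv.2).imp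
      (fun h b hb => ⟨hu.1, hT.connected.isAncestor_trans h hb.2⟩)
      (fun h b hb => ⟨hv.1, hT.connected.isAncestor_trans h hb.2⟩)
  have e1 := hd w x y z
  have e2 := hd w y x z
  have e3 := hd w z x y
  generalize hA : T.properAncestors r = A at *
  -- If `m` of the four vertices lie below `v`, counted with repetition, then `K v = max (m - 2) 0`.
  -- A pairing's count exceeds this only when `m = 2` and the pairing matches those two.
  set K : V → ℕ := fun v =>
    (if v ∈ A w ∧ v ∈ A x then 1 else 0) * (if v ∈ A y ∨ v ∈ A z then 1 else 0) +
      (if v ∈ A w ∨ v ∈ A x then 1 else 0) * (if v ∈ A y ∧ v ∈ A z then 1 else 0) with hK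
  set N₁ : V → ℕ := fun v => (if v ∈ A w ∧ v ∈ A x then 1 else 0) +
    (if v ∈ A y ∧ v ∈ A z then 1 else 0) with hN₁
  set N₂ : V → ℕ := fun v => (if v ∈ A w ∧ v ∈ A y then 1 else 0) +
    (if v ∈ A x ∧ v ∈ A z then 1 else 0) with hN₂
  set N₃ : V → ℕ := fun v => (if v ∈ A w ∧ v ∈ A z then 1 else 0) +
    (if v ∈ A x ∧ v ∈ A y then 1 else 0) with hN₃
  have k1 : ∀ v, K v ≤ N₁ v := by
    intro v
    by_cases v ∈ A w <;> by_cases v ∈ A x <;> by_cases v ∈ A y <;> by_cases v ∈ A z <;> simp [*]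
  have k2 : ∀ v, K v ≤ N₂ v := by
    intro v
    by_cases v ∈ A w <;> by_cases v ∈ A x <;> by_cases v ∈ A y <;> by_cases v ∈ A z <;> simp [*]
  have k3 : ∀ v, K v ≤ N₃ v := by
    intro v
    by_cases v ∈ A w <;> by_cases v ∈ A x <;> by_cases v ∈ A y <;> by_cases v ∈ A z <;> simp [*]
  -- Otherwise some `u` separates `w, x` from `y, z` and some `v` separates `w, y` from `x, z`;
  -- their descendant sets would cross.
  have hor : (∀ v, N₁ v = K v) ∨ (∀ v, N₂ v = K v) := by
    by_contra! hcon
    obtain ⟨⟨u, hu⟩, v, hv⟩ := hcon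
    have hu' : (u ∈ A w ∧ u ∈ A x ∧ u ∉ A y ∧ u ∉ A z) ∨
        (u ∉ A w ∧ u ∉ A x ∧ u ∈ A y ∧ u ∈ A z) := by
      revert hu
      by_cases u ∈ A w <;> by_cases u ∈ A x <;> by_cases u ∈ A y <;> by_cases u ∈ A z <;>
        simp [*]
    have hv' : (v ∈ A w ∧ v ∉ A x ∧ v ∈ A y ∧ v ∉ A z) ∨
        (v ∉ A w ∧ v ∈ A x ∧ v ∉ A y ∧ v ∈ A z) := by
      revert hv
      by_cases v ∈ A w <;> by_cases v ∈ A x <;> by_cases v ∈ A y <;> by_cases v ∈ A z <;>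
        simp [*]
    clear hu hv
    rcases hu' with ⟨h1, h2, h3, h4⟩ | ⟨h1, h2, h3, h4⟩ <;>
      rcases hv' with ⟨h5, h6, h7, h8⟩ | ⟨h5, h6, h7, h8⟩
    · exact (hlam w u v h1 h5).elim (fun h => h3 (h y h7)) (fun h => h6 (h x h2))
    · exact (hlam x u v h2 h6).elim (fun h => h4 (h z h8)) (fun h => h5 (h w h1))
    · exact (hlam y u v h3 h7).elim (fun h => h1 (h w h5)) (fun h => h8 (h z h4))
    · exact (hlam z u v h4 h8).elim (fun h => h2 (h x h6)) (fun h => h7 (h y h3))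
  have s1 : Finset.univ.sum K ≤ Finset.univ.sum N₁ := Finset.sum_le_sum fun v _ => k1 v
  have s2 : Finset.univ.sum K ≤ Finset.univ.sum N₂ := Finset.sum_le_sum fun v _ => k2 v
  have s3 : Finset.univ.sum K ≤ Finset.univ.sum N₃ := Finset.sum_le_sum fun v _ => k3 v
  have hs : Finset.univ.sum N₁ = Finset.univ.sum K ∨ Finset.univ.sum N₂ = Finset.univ.sum K :=
    hor.imp (fun h => Finset.sum_congr rfl fun v _ => h v)
      (fun h => Finset.sum_congr rfl fun v _ => h v)
  unfold fourPointMax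
  omega

theorem IsTree.exists_isParent_of_degree_ne_one [Fintype V] [Nontrivial V] [DecidableRel T.Adj]
    (hT : T.IsTree) {r y : V} (hy : T.degree y ≠ 1) : ∃ z, T.IsParent r y z := by
  have hpos := hT.connected.preconnected.degree_pos_of_nontrivial y
  have hcard : 1 < (T.neighborFinset y).card := by
    rw [T.card_neighborFinset_eq_degree]
    omega
  obtain ⟨a, ha, b, hb, hab⟩ := Finset.one_lt_card.1 hcard
  rw [mem_neighborFinset] at ha hb
  rcases hT.isParent_or_isParent r ha with h | h
  · exact ⟨a, h⟩
  rcases hT.isParent_or_isParent r hb with h' | h'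
  · exact ⟨b, h'⟩
  exact absurd (hT.isParent_unique h h') hab

theorem IsTree.exists_ne_isParent_root [Fintype V] [Nontrivial V] [DecidableRel T.Adj]
    (hT : T.IsTree) {r : V} (hr : T.degree r ≠ 1) :
    ∃ a b, a ≠ b ∧ T.IsParent r r a ∧ T.IsParent r r b := by
  have hpos := hT.connected.preconnected.degree_pos_of_nontrivial r
  have hcard : 1 < (T.neighborFinset r).card := by
    rw [T.card_neighborFinset_eq_degree]
    omega
  obtain ⟨a, ha, b, hb, hab⟩ := Finset.one_lt_card.1 hcard
  rw [mem_neighborFinset] at ha hb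
  exact ⟨a, b, hab, (hT.isParent_or_isParent r ha).resolve_right fun h => h.ne_root rfl,
    (hT.isParent_or_isParent r hb).resolve_right fun h => h.ne_root rfl⟩

/-- A leaf other than the root is an ancestor only of itself. -/
theorem IsTree.eq_of_isAncestor_of_degree_eq_one [Fintype V] [DecidableRel T.Adj]
    (hT : T.IsTree) {r v x : V} (hvr : v ≠ r) (hv : T.degree v = 1) (h : T.IsAncestor r v x) :
    x = v := by
  by_contra hne
  obtain ⟨b, hb, hbx⟩ := hT.connected.exists_adj_dist_add_one_eq (Ne.symm hne)
  obtain ⟨p, hp⟩ := hT.connected.exists_isParent hvr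
  obtain ⟨a, ha⟩ := Finset.card_eq_one.1 ((T.card_neighborFinset_eq_degree v).trans hv)
  have hb' := (mem_neighborFinset _ _ _).2 hb
  have hp' := (mem_neighborFinset _ _ _).2 hp.1
  rw [ha, Finset.mem_singleton] at hb' hp'
  obtain rfl : b = p := hb'.trans hp'.symm
  have h1 := hT.connected.dist_triangle (u := r) (v := b) (w := x)
  have h2 := hp.2
  unfold IsAncestor at h
  omega

theorem IsTree.exists_degree_ne_one [Fintype V] [DecidableRel T.Adj] (hT : T.IsTree)
    (hcard : 3 ≤ Fintype.card V) : ∃ r, T.degree r ≠ 1 := by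
  by_contra! h
  -- If all degrees were `1`, then `n = 2(n - 1)`, forcing `n = 2`.
  have h1 := T.sum_degrees_eq_twice_card_edges
  have h2 := hT.card_edgeFinset
  simp only [h, Finset.sum_const, Finset.card_univ, smul_eq_mul, mul_one] at h1
  omega

/-- Inclusion-exclusion turns the union sum into a function `B` of each vertex and a correction on
the intersection. Testing ancestor-descendant pairs, where the intersection depends only on the
ancestor, together with two children of the root, forces `B = 0`; the coefficients then follow edge
by edge. -/
theorem IsTree.coefficients_eq_zero [Fintype V] [DecidableEq V] [Nontrivial V]
    [DecidableRel T.Adj] (hT : T.IsTree) {r : V} (hr : T.degree r ≠ 1) {c₀ c₁ : ℝ} {α β : V → ℝ}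
    (hα : ∀ v, T.degree v = 1 → α v = 0) (hβ : ∀ v, T.degree v = 1 → β v = 0)
    (h : ∀ w x, w ≠ x → c₀ + c₁ * (T.dist r w + T.dist r x) +
      ∑ v ∈ T.properAncestors r w ∩ T.properAncestors r x, α v +
      ∑ v ∈ T.properAncestors r w ∪ T.properAncestors r x, β v = 0) :
    c₀ = 0 ∧ c₁ = 0 ∧ ∀ v ≠ r, α v = 0 ∧ β v = 0 := by
  let B : V → ℝ := fun x => c₁ * T.dist r x + ∑ v ∈ T.properAncestors r x, β v
  let γ : V → ℝ := fun x => ∑ v ∈ T.properAncestors r x, (α v - β v)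
  have hrel : ∀ w x, w ≠ x → c₀ + B w + B x +
      ∑ v ∈ T.properAncestors r w ∩ T.properAncestors r x, (α v - β v) = 0 := by
    intro w x hwx
    have h1 := h w x hwx
    have h2 := Finset.sum_union_inter (s₁ := T.properAncestors r w)
      (s₂ := T.properAncestors r x) (f := β)
    rw [Finset.sum_sub_distrib]
    simp only [B]
    linarith
  have hanc : ∀ w x, w ≠ x → T.IsAncestor r w x → c₀ + B w + B x + γ w = 0 := by
    intro w x hwx hw
    have h1 := hrel w x hwx
    rwa [Finset.inter_eq_left.2] at h1
    intro v hv
    rw [mem_properAncestors] at hv ⊢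
    exact ⟨hv.1, hT.connected.isAncestor_trans hv.2 hw⟩
  have hpar : ∀ {p y}, T.IsParent r p y → c₀ + B p + B y + γ p = 0 := fun hp =>
    hanc _ _ hp.1.ne' hp.isAncestor
  have hBr : B r = 0 := by simp [B, hT.connected.properAncestors_root]
  have hγr : γ r = 0 := by simp [γ, hT.connected.properAncestors_root]
  have hBstep : ∀ {p y}, T.IsParent r p y → B y = B p + c₁ + β y := by
    intro p y hp
    simp only [B]
    rw [hT.properAncestors_of_isParent hp, Finset.sum_insert hp.notMem_properAncestors, ← hp.2]
    push_cast
    ring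
  have hγstep : ∀ {p y}, T.IsParent r p y → γ y = γ p + (α y - β y) := by
    intro p y hp
    simp only [γ]
    rw [hT.properAncestors_of_isParent hp, Finset.sum_insert hp.notMem_properAncestors]
    ring
  -- Two children `a`, `b` of the non-leaf root have no common non-root ancestor: `c₀ + B a`, `c₀ +
  -- B b` and `c₀ + B a + B b` all vanish.
  have hc₀ : c₀ = 0 := by
    obtain ⟨a, b, hab, ha, hb⟩ := hT.exists_ne_isParent_root hr
    have h1 := hpar ha
    have h2 := hpar hb
    have h3 := hrel a b hab
    rw [hT.properAncestors_of_isParent ha, hT.properAncestors_of_isParent hb,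
      hT.connected.properAncestors_root, Finset.inter_insert_of_notMem (by simpa using hab.symm)]
      at h3
    simp only [insert_empty_eq, Finset.inter_empty, Finset.sum_empty] at h3
    linarith
  have hB : ∀ y, B y = 0 := by
    intro y
    induction y using hT.connected.induction_on_isParent r with
    | root => exact hBr
    | step p y hp ih =>
      have h1 := hpar hp
      by_cases hpr : p = r
      · rw [hpr] at h1
        linarith
      · obtain ⟨p', hp'⟩ := hT.connected.exists_isParent hpr
        have h2 := hpar hp'
        have h3 := hanc p' y (by
          rintro rfl
          have := hp.2
          have := hp'.2
          omega) (hT.connected.isAncestor_trans hp'.isAncestor hp.isAncestor)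
        linarith
  have hγ : ∀ {p y}, T.IsParent r p y → γ p = 0 := by
    intro p y hp
    have h1 := hpar hp
    rw [hB, hB] at h1
    linarith
  have hcβ : ∀ v ≠ r, c₁ + β v = 0 := by
    intro v hv
    obtain ⟨p, hp⟩ := hT.connected.exists_isParent hv
    have h1 := hBstep hp
    rw [hB, hB] at h1
    linarith
  -- A leaf is not the root, and `β` vanishes there.
  have hc₁ : c₁ = 0 := by
    obtain ⟨l, hl⟩ := hT.exists_vert_degree_one_of_nontrivial
    have h1 := hcβ l (by rintro rfl; exact hr hl)
    rwa [hβ l hl, add_zero] at h1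
  refine ⟨hc₀, hc₁, fun v hv => ?_⟩
  have hβv : β v = 0 := by simpa [hc₁] using hcβ v hv
  refine ⟨?_, hβv⟩
  by_cases hd : T.degree v = 1
  · exact hα v hd
  obtain ⟨p, hp⟩ := hT.connected.exists_isParent hv
  obtain ⟨z, hz⟩ := hT.exists_isParent_of_degree_ne_one (r := r) hd
  have h1 := hγstep hp
  rw [hγ hp, hγ hz, hβv] at h1
  linarith

end SimpleGraph

/-! ### Splitting the matrix into planes indexed by the non-leaves -/

theorem Fintype.sum_subtype_of_eq_zero {V M : Type*} [Fintype V] [AddCommMonoid M] {p : V → Prop}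
    [DecidablePred p] {f : V → M} (h : ∀ v, ¬ p v → f v = 0) : ∑ i : {v // p v}, f i = ∑ v, f v := by
  rw [← Finset.sum_subtype (Finset.univ.filter p) (by simp) f]
  exact Finset.sum_subset (Finset.subset_univ _) fun v _ hv => h v (by simpa using hv)

section hyperbolic

variable {V : Type*} (T : SimpleGraph V) (r : V)

/-- The sum of the depths of the two vertices of a pair. -/
noncomputable def depthSum : Sym2 V → ℝ :=
  Sym2.lift ⟨fun w x => T.dist r w + T.dist r x, fun _ _ => add_comm _ _⟩

theorem depthSum_mk (w x : V) : depthSum T r s(w, x) = T.dist r w + T.dist r x := rfl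

variable [Fintype V]

open Classical in
/-- The indicator of the pairs both of whose vertices have the non-root ancestor `v`. -/
noncomputable def bothBelow (v : V) (e : Sym2 V) : ℝ :=
  if ∀ x ∈ e, v ∈ T.properAncestors r x then 1 else 0

open Classical in
/-- The indicator of the pairs at least one of whose vertices has the non-root ancestor `v`. -/
noncomputable def someBelow (v : V) (e : Sym2 V) : ℝ :=
  if ∃ x ∈ e, v ∈ T.properAncestors r x then 1 else 0

theorem bothBelow_mk [DecidableEq V] (v w x : V) : bothBelow T r v s(w, x) =
    if v ∈ T.properAncestors r w ∧ v ∈ T.properAncestors r x then 1 else 0 := by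
  simp [bothBelow]

theorem someBelow_mk [DecidableEq V] (v w x : V) : someBelow T r v s(w, x) =
    if v ∈ T.properAncestors r w ∨ v ∈ T.properAncestors r x then 1 else 0 := by
  simp [someBelow]

theorem bothBelow_root (e : Sym2 V) : bothBelow T r r e = 0 := by
  classical
  induction e using Sym2.ind with | _ w x
  simp [bothBelow_mk, SimpleGraph.mem_properAncestors]

variable {T r}

theorem bothBelow_eq_zero_of_degree_eq_one [DecidableRel T.Adj] (hT : T.IsTree) {v : V}
    (hv : T.degree v = 1) {e : Sym2 V} (he : ¬ e.IsDiag) : bothBelow T r v e = 0 := by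
  classical
  induction e using Sym2.ind with | _ w x
  rw [bothBelow_mk, if_neg]
  rintro ⟨hw, hx⟩
  rw [SimpleGraph.mem_properAncestors] at hw hx
  exact he ((hT.eq_of_isAncestor_of_degree_eq_one hw.1 hv hw.2).trans
    (hT.eq_of_isAncestor_of_degree_eq_one hx.1 hv hx.2).symm)

theorem Max4PC_apply_eq (hT : T.IsTree) (e f : VertexPair V) :
    Max4PC T e f = depthSum T r e + depthSum T r f -
      2 * ∑ v, (bothBelow T r v e * someBelow T r v f + someBelow T r v e * bothBelow T r v f) := by
  classical
  obtain ⟨e, he⟩ := e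
  obtain ⟨f, hf⟩ := f
  induction e using Sym2.ind with | _ w x
  induction f using Sym2.ind with | _ y z
  have h := congrArg (Nat.cast (R := ℝ)) (hT.fourPointMax_add_two_mul_card r w x y z)
  push_cast at h
  simp only [Max4PC, Matrix.of_apply, fourPointMaxSym_mk, depthSum_mk, bothBelow_mk,
    someBelow_mk]
  linarith

variable (T r)

/-- The first vectors of the hyperbolic planes that `Max4PC` splits into. -/
noncomputable def planeLeft [DecidableEq V] (v : V) (e : VertexPair V) : ℝ :=
  if v = r then 1 else bothBelow T r v e

/-- The second vectors of the hyperbolic planes that `Max4PC` splits into. -/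
noncomputable def planeRight [DecidableEq V] (v : V) (e : VertexPair V) : ℝ :=
  if v = r then depthSum T r e else -2 * someBelow T r v e

variable {T r}

/-- The root is excluded from `properAncestors`, so its slot is free to carry the depth terms. Leaf
terms vanish because `e` and `f` are pairs of distinct vertices. -/
theorem Max4PC_eq_sum_planes [DecidableEq V] [DecidableRel T.Adj] (hT : T.IsTree)
    (hr : T.degree r ≠ 1) (e f : VertexPair V) :
    Max4PC T e f = ∑ i : {v // T.degree v ≠ 1},
      (planeLeft T r i e * planeRight T r i f + planeRight T r i e * planeLeft T r i f) := by
  let φ : V → ℝ := fun v =>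
    planeLeft T r v e * planeRight T r v f + planeRight T r v e * planeLeft T r v f
  have hφ : ∀ v, φ v = (if v = r then depthSum T r e + depthSum T r f else 0) +
      -2 * (bothBelow T r v e * someBelow T r v f + someBelow T r v e * bothBelow T r v f) := by
    intro v
    by_cases hv : v = r
    · subst hv
      simp [φ, planeLeft, planeRight, bothBelow_root, add_comm]
    · simp only [φ, planeLeft, planeRight, hv, if_false]
      ring
  have hleaf : ∀ v, T.degree v = 1 → φ v = 0 := by
    intro v hv
    rw [hφ, if_neg (by rintro rfl; exact hr hv), bothBelow_eq_zero_of_degree_eq_one hT hv e.2,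
      bothBelow_eq_zero_of_degree_eq_one hT hv f.2]
    simp
  have hsum : ∑ i : {v // T.degree v ≠ 1}, φ i = ∑ v, φ v := 
    Fintype.sum_subtype_of_eq_zero fun v hv => hleaf v (not_not.1 hv)
  refine Eq.trans ?_ hsum.symm
  rw [Max4PC_apply_eq (r := r) hT, Finset.sum_congr rfl fun v _ => hφ v,
    Finset.sum_add_distrib (f := fun v => if v = r then _ else _),
    Finset.sum_ite_eq' Finset.univ r, ← Finset.mul_sum]
  simp
  ring

theorem linearIndependent_planes [DecidableEq V] [Nontrivial V] [DecidableRel T.Adj]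
    (hT : T.IsTree) (hr : T.degree r ≠ 1) :
    LinearIndependent ℝ (Sum.elim (fun i : {v // T.degree v ≠ 1} => planeLeft T r i)
      (fun i : {v // T.degree v ≠ 1} => planeRight T r i)) := by
  rw [Fintype.linearIndependent_iff]
  intro c hc
  -- Extending the coefficients by zero to the leaves makes the sums run over all of `V` and
  -- supplies the vanishing needed at leaves.
  let α : V → ℝ := fun v => if h : T.degree v ≠ 1 then c (Sum.inl ⟨v, h⟩) else 0
  let β : V → ℝ := fun v => if h : T.degree v ≠ 1 then c (Sum.inr ⟨v, h⟩) else 0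
  have hsum : ∀ e : VertexPair V,
      ∑ v, (α v * planeLeft T r v e + β v * planeRight T r v e) = 0 := by
    intro e
    have h1 := congrFun hc e
    rw [Fintype.sum_sum_type, ← Finset.sum_add_distrib] at h1
    simp only [Finset.sum_apply, Pi.add_apply, Pi.smul_apply, smul_eq_mul, Sum.elim_inl,
      Sum.elim_inr, Pi.zero_apply] at h1
    rw [← h1, ← Fintype.sum_subtype_of_eq_zero (p := fun v => T.degree v ≠ 1)
      (fun v hv => by simp [α, β, not_not.1 hv])]
    exact Finset.sum_congr rfl fun i _ => by simp [α, β, i.2]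
  -- The root's coefficients serve as `c₀` and `c₁`; the factor `-2` comes from `planeRight`.
  have key := hT.coefficients_eq_zero hr (c₀ := α r) (c₁ := β r) (α := α) (β := fun v => -2 * β v)
    (fun v hv => by simp [α, hv]) (fun v hv => by simp [β, hv]) (by
      intro w x hwx
      have h1 := hsum ⟨s(w, x), by simpa using hwx⟩
      have h2 : ∀ v, α v * planeLeft T r v ⟨s(w, x), by simpa using hwx⟩ +
          β v * planeRight T r v ⟨s(w, x), by simpa using hwx⟩ =
          (if v = r then α r + β r * (T.dist r w + T.dist r x) else 0) +
          (if v ∈ T.properAncestors r w ∩ T.properAncestors r x then α v else 0) +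
          (if v ∈ T.properAncestors r w ∪ T.properAncestors r x then -2 * β v else 0) := by
        intro v
        by_cases hv : v = r
        · subst hv
          simp [planeLeft, planeRight, depthSum_mk, SimpleGraph.mem_properAncestors]
        · simp [planeLeft, planeRight, hv, bothBelow_mk, someBelow_mk]
          ring_nf
      rw [Finset.sum_congr rfl fun v _ => h2 v, Finset.sum_add_distrib, Finset.sum_add_distrib,
        Finset.sum_ite_eq' Finset.univ r, Finset.sum_ite_mem, Finset.sum_ite_mem] at h1
      simpa using h1)
  obtain ⟨k0, k1, k2⟩ := key
  have hα : ∀ v, α v = 0 := by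
    intro v
    by_cases hv : v = r
    · rw [hv, k0]
    · exact (k2 v hv).1
  have hβ : ∀ v, β v = 0 := by
    intro v
    by_cases hv : v = r
    · rw [hv, k1]
    · simpa using (k2 v hv).2
  rintro (⟨v, hv⟩ | ⟨v, hv⟩)
  · simpa [α, hv] using hα v
  · simpa [β, hv] using hβ v

end hyperbolic

theorem mainTheorem4 {V : Type*} [Fintype V] [DecidableEq V] (T : SimpleGraph V)
    [DecidableRel T.Adj] (hT : T.IsTree) (n p : ℕ) (hn : Fintype.card V = n) (hn3 : 3 ≤ n)
    (hp : numLeaves T = p) :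
    inertia (Max4PC_isHermitian T) = (n.choose 2 - 2 * (n - p), n - p, n - p) ∧
      Module.finrank ℝ (LinearMap.ker (Max4PC T).mulVecLin) = n.choose 2 - 2 * (n - p) := by
  have : Nontrivial V := Fintype.one_lt_card_iff_nontrivial.1 (by omega)
  obtain ⟨r, hr⟩ := hT.exists_degree_ne_one (by omega)
  have hcard : Fintype.card {v // T.degree v ≠ 1} = n - p := by
    rw [Fintype.card_subtype_compl, hn, ← hp, numLeaves, Fintype.card_subtype]
  have hpairs : Fintype.card (VertexPair V) = n.choose 2 := by
    rw [Sym2.card_subtype_not_diag, hn]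
  have h := inertia_of_hyperbolic (Max4PC_isHermitian T) _ _ (linearIndependent_planes hT hr)
    (Max4PC_eq_sum_planes hT hr)
  rwa [hcard, hpairs] at h
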